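/- Let $\Sigma_0\subset\mathbb{R}^2$ be a bounded open set with Lipschitz boundary, $L>0$, $\Gamma=(-L,L)$, and $\Omega=\Sigma_0\times\Gamma\subset\mathbb{R}^3$. For $d>0$ put $$\Gamma^d=\{k\in\mathbb{Z}: kd\in(-L,L-d)\},\qquad \Sigma^d=\bigcup_{k\in\Gamma^d}\Sigma_0\times\{kd\}.$$ Let $\nu$ be a unit normal on the hypersurface in question (the outer one on $\partial\Omega$, and $e_3$ on $\Sigma^d$), and let $u_T=(\nu\times u)\times\nu$ be the tangential trace of a field $u\in H(\mathrm{curl};\Omega)$, where $\nu\times u$ is the trace given by Green's formula. Define $$X^d=\{u\in H(\mathrm{curl};\Omega): u_T\in L^2(\partial\Omega;\mathbb{C}^3),\ u_T\in L^2(\Sigma^d;\mathbb{C}^3)\}.$$ Let $\omega,\mu,\lambda>0$ be real constants, and let $\varepsilon^d:\Omega\to\mathbb{C}$ and $\sigma^d:\Sigma^d\to\mathbb{C}$ be measurable functions such that, for some constants $c>0$ and $C$, $$c\le\operatorname{Im}\varepsilon^d(x)\le C,\quad |\operatorname{Re}\varepsilon^d(x)|\le C\quad\text{for all }x\in\Omega,$$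 $$c\le\tfrac1d\operatorname{Re}\sigma^d(x)\le C,\quad \big|\tfrac1d\operatorname{Im}\sigma^d(x)\big|\le C\quad\text{for all }x\in\Sigma^d.$$ For $u,v\in X^d$ let $$a^d(u,v)=\int_\Omega\frac1\mu(\nabla\times u)\cdot(\nabla\times\bar v)\,dx-\int_\Omega\omega^2\varepsilon^d\,u\cdot\bar v\,dx-\int_{\Sigma^d}i\omega\sigma^d\,u_T\cdot\bar v_T\,do_x-\int_{\partial\Omega}i\omega\lambda\,u_T\cdot\bar v_T\,do_x .$$ Then, for every $d>0$ and every $J_a\in L^2(\Omega;\mathbb{C}^3)$, there is a unique $E^d\in X^d$ such that $$a^d(E^d,\Psi)=i\omega\int_\Omega J_a\cdot\bar\Psi\,dx\qquad\text{for all }\Psi\in X^d .$$ -/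

import Mathlib

open MeasureTheory Set
open scoped MeasureTheory Matrix

namespace LayeredMaxwell

/-- The plane. -/
abbrev R2 := EuclideanSpace ℝ (Fin 2)

/-- Euclidean space; the third coordinate of `x` is `x 2`. -/
abbrev R3 := EuclideanSpace ℝ (Fin 3)

/-- Complex vectors; `inner ℂ b a` is `a · b̄ = ∑ i, a i * conj (b i)`. -/
abbrev C3 := EuclideanSpace ℂ (Fin 3)

/-! ### Geometry -/

/-- Bounded open planar set whose boundary is, near each of its points and in suitable orthonormal
coordinates, the graph of a Lipschitz function, the set lying on one side of this graph. -/
structure IsBoundedLipschitz (S : Set R2) : Prop where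
  isOpen : IsOpen S
  isBounded : Bornology.IsBounded S
  chart : ∀ p ∈ frontier S, ∃ (e : R2 ≃ₗᵢ[ℝ] R2) (K : NNReal) (h : ℝ → ℝ) (r : ℝ),
    0 < r ∧ LipschitzWith K h ∧
      ∀ x ∈ Metric.ball p r, x ∈ S ↔ (e (x - p)) 1 < h ((e (x - p)) 0)

/-- The cylinder `Ω = S × (-L, L)`. -/
def prism (S : Set R2) (L : ℝ) : Set R3 :=
  {x | !₂[x 0, x 1] ∈ S ∧ x 2 ∈ Ioo (-L) L}

/-- The indices of the sheets: the integers `k` with `k d ∈ (-L, L - d)`. -/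
def sheetIndices (L d : ℝ) : Set ℤ :=
  {k | (k : ℝ) * d ∈ Ioo (-L) (L - d)}

/-- The single sheet `S × {t}`. -/
def sheet (S : Set R2) (t : ℝ) : Set R3 :=
  {x | !₂[x 0, x 1] ∈ S ∧ x 2 = t}

/-- The union `Σ^d` of all sheets. -/
def sheets (S : Set R2) (L d : ℝ) : Set R3 :=
  ⋃ k ∈ sheetIndices L d, sheet S (k * d)

/-- `n` is the outer unit normal of `D` at `x`: to first order at `x`, the set `D` is the
half-space `{y | ⟪y - x, n⟫ < 0}`. -/
def IsOuterUnitNormal (D : Set R3) (x n : R3) : Prop :=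
  ‖n‖ = 1 ∧ ∀ η > 0, ∃ δ > 0, ∀ y ∈ Metric.ball x δ,
    (inner ℝ (y - x) n < -η * ‖y - x‖ → y ∈ D) ∧ (η * ‖y - x‖ < inner ℝ (y - x) n → y ∉ D)

open Classical in
/-- The outer unit normal field of `D`; it is `0` at points without a normal (for a Lipschitz set
these boundary points, such as edges and corners, have surface measure zero). -/
noncomputable def outerNormal (D : Set R3) (x : R3) : R3 :=
  if h : ∃ n, IsOuterUnitNormal D x n then h.choose else 0

/-! ### Vector calculus -/

/-- The cross product `n × a` of a real and a complex vector. -/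
noncomputable def crossC (n : R3) (a : C3) : C3 :=
  WithLp.toLp 2 ((fun i => ((n i : ℝ) : ℂ)) ⨯₃ (fun i => a i))

/-- The partial derivative `∂ⱼ φₖ`. -/
noncomputable def pderiv (φ : R3 → C3) (j k : Fin 3) (x : R3) : ℂ :=
  (fderiv ℝ φ x (EuclideanSpace.single j 1)) k

/-- The pointwise curl of a smooth vector field. -/
noncomputable def smoothCurl (φ : R3 → C3) (x : R3) : C3 :=
  !₂[pderiv φ 1 2 x - pderiv φ 2 1 x,
     pderiv φ 2 0 x - pderiv φ 0 2 x,
     pderiv φ 0 1 x - pderiv φ 1 0 x]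

/-- Smooth vector fields with compact support contained in `U`. -/
def IsTestField (U : Set R3) (φ : R3 → C3) : Prop :=
  ContDiff ℝ (⊤ : ℕ∞) φ ∧ HasCompactSupport φ ∧ tsupport φ ⊆ U

/-! ### Function spaces -/

/-- `L²(Ω; ℂ³)`. -/
noncomputable abbrev L2 (Ω : Set R3) := Lp C3 2 ((volume : Measure R3).restrict Ω)

/-- `L²(Λ; ℂ³)` for the surface measure (two-dimensional Hausdorff measure) on `Λ`. -/
noncomputable abbrev L2Surf (Λ : Set R3) := Lp C3 2 ((μHE[2] : Measure R3).restrict Λ)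

/-- `w = ∇ × u` in `Ω` in the sense of distributions. -/
def IsWeakCurl (Ω : Set R3) (u w : R3 → C3) : Prop :=
  ∀ φ, IsTestField Ω φ →
    ∫ x in Ω, inner ℂ (φ x) (w x) = ∫ x in Ω, inner ℂ (smoothCurl φ x) (u x)

/-- The space `H(curl; Ω)`. -/
def HCurl (Ω : Set R3) : Set (L2 Ω) :=
  {u | ∃ w : L2 Ω, IsWeakCurl Ω u w}

open Classical in
/-- The curl of `u ∈ H(curl; Ω)` (and `0` for the other `u`). -/
noncomputable def curl {Ω : Set R3} (u : L2 Ω) : L2 Ω :=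
  if h : ∃ w : L2 Ω, IsWeakCurl Ω u w then h.choose else 0

/-- Let `Λ = U ∩ ∂D` be a hypersurface with unit normal `ν` pointing out of `D`, and let `w` be the
curl of `u`. Then `g` is the tangential trace `u_T = (ν × u) × ν` of `u` on `Λ`, taken from `D`:
the trace `t = ν × u` is the one determined by Green's formula
`∫_D (∇ × u) · φ̄ - u · (∇ × φ̄) = ∫_Λ (ν × u) · φ̄`, it is square integrable,
and `g = t × ν = -(ν × t)`. -/
def IsTangentialTrace (D U Λ : Set R3) (ν : R3 → R3) (u w g : R3 → C3) : Prop :=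
  ∃ t : R3 → C3, MemLp t 2 ((μHE[2] : Measure R3).restrict Λ) ∧
    (∀ φ, IsTestField U φ →
      ∫ x in D, (inner ℂ (φ x) (w x) - inner ℂ (smoothCurl φ x) (u x)) =
        ∫ x in Λ, inner ℂ (φ x) (t x) ∂μHE[2]) ∧
    (∀ᵐ x ∂(μHE[2] : Measure R3).restrict Λ,
      g x = -crossC (ν x) (t x) ∧ t x = crossC (ν x) (g x))

/-- `g` is the tangential trace of `u` on `∂Ω`. -/
def IsBoundaryTrace {Ω : Set R3} (u : L2 Ω) (g : R3 → C3) : Prop :=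
  IsTangentialTrace Ω univ (frontier Ω) (outerNormal Ω) u (curl u) g

/-- `g` is the tangential trace of `u` on every sheet of `Σ^d`. Sheets lie inside `Ω`, and the trace
is taken from the part of `Ω` below the sheet, with `ν = e₃`. -/
def IsSheetTrace (S : Set R2) (L d : ℝ) (u : L2 (prism S L)) (g : R3 → C3) : Prop :=
  ∀ k ∈ sheetIndices L d,
    IsTangentialTrace (prism S L ∩ {x | x 2 < k * d}) (prism S L) (sheet S (k * d))
      (fun _ => EuclideanSpace.single 2 1) u (curl u) g

open Classical in
/-- The tangential trace `u_T ∈ L²(∂Ω; ℂ³)` (`0` if there is none). -/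
noncomputable def boundaryTrace {Ω : Set R3} (u : L2 Ω) : L2Surf (frontier Ω) :=
  if h : ∃ g : L2Surf (frontier Ω), IsBoundaryTrace u g then h.choose else 0

open Classical in
/-- The tangential trace `u_T ∈ L²(Σ^d; ℂ³)` (`0` if there is none). -/
noncomputable def sheetTrace (S : Set R2) (L d : ℝ) (u : L2 (prism S L)) :
    L2Surf (sheets S L d) :=
  if h : ∃ g : L2Surf (sheets S L d), IsSheetTrace S L d u g then h.choose else 0

/-- The space `X^d`: the fields in `H(curl; Ω)` whose tangential traces on `∂Ω` and on `Σ^d` are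
square integrable. -/
def X (S : Set R2) (L d : ℝ) : Set (L2 (prism S L)) :=
  {u | u ∈ HCurl (prism S L) ∧
    (∃ g : L2Surf (frontier (prism S L)), IsBoundaryTrace u g) ∧
    (∃ g : L2Surf (sheets S L d), IsSheetTrace S L d u g)}

/-- The sesquilinear form `a^d`. -/
noncomputable def form (S : Set R2) (L d ω μ lam : ℝ) (ε σ : R3 → ℂ)
    (u v : L2 (prism S L)) : ℂ :=
  (∫ x in prism S L, ((1 / μ : ℝ) : ℂ) * inner ℂ (curl v x) (curl u x))
    - (∫ x in prism S L, (ω : ℂ) ^ 2 * ε x * inner ℂ (v x) (u x))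
    - (∫ x in sheets S L d,
        Complex.I * ω * σ x * inner ℂ (sheetTrace S L d v x) (sheetTrace S L d u x) ∂μHE[2])
    - ∫ x in frontier (prism S L),
        Complex.I * ω * lam * inner ℂ (boundaryTrace v x) (boundaryTrace u x) ∂μHE[2]

end LayeredMaxwell

open LayeredMaxwell

open Filter Topology

namespace LayeredMaxwell

/-! ### Square-integrable fields -/

section SquareIntegrable

variable {α : Type*} [MeasurableSpace α] {m : Measure α}

/-! The argument is Lax–Milgram on a graph. A field in `X` is replaced by the quadruple of itself,
its curl, its trace on the sheets and its trace on the boundary, an element of a product of four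
`L²` spaces. On quadruples the form is a diagonal multiplication operator with bounded coefficients
(`form_eq_inner`).

Quadruples coming from fields form a closed subspace (`isClosed_fieldSpace`): all defining relations
are Green formulas tested with smooth fields, together with pointwise cross-product relations, and
both survive `L²` limits. Curl and traces are determined by the field (`IsFieldData.ext`), so this
subspace corresponds bijectively to `X`, and the arbitrary choices in `curl`, `sheetTrace` and
`boundaryTrace` are harmless. Pairing traces with test fields needs surfaces of finite area, which
is where the Lipschitz boundary enters.

Coercivity comes from multiplying the form by `1 + iM` with `M` large. The curl term keeps its real
part, while absorption in `ε`, `σ` and `lam`, multiplied by `M`, dominates the real part of `ε` and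
the imaginary part of `σ`. All four coefficients then have real parts bounded below by positive
constants, so no compactness argument is needed. -/

lemma memLp_integrable_inner {f g : α → C3} (hf : MemLp f 2 m) (hg : MemLp g 2 m) :
    Integrable (fun x => inner ℂ (f x) (g x)) m := by
  refine (L2.integrable_inner (𝕜 := ℂ) hf.toLp hg.toLp).congr ?_
  filter_upwards [hf.coeFn_toLp, hg.coeFn_toLp] with x h1 h2
  rw [h1, h2]

lemma inner_toLp_toLp {f g : α → C3} (hf : MemLp f 2 m) (hg : MemLp g 2 m) :
    inner ℂ hf.toLp hg.toLp = ∫ x, inner ℂ (f x) (g x) ∂m := by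
  rw [L2.inner_def]
  refine integral_congr_ae ?_
  filter_upwards [hf.coeFn_toLp, hg.coeFn_toLp] with x h1 h2
  rw [h1, h2]

lemma tendsto_integral_inner {ψ f : α → C3} {u : ℕ → α → C3} (hψ : MemLp ψ 2 m)
    (hu : ∀ n, MemLp (u n) 2 m) (hf : MemLp f 2 m)
    (h : Tendsto (fun n => eLpNorm (u n - f) 2 m) atTop (𝓝 0)) :
    Tendsto (fun n => ∫ x, inner ℂ (ψ x) (u n x) ∂m) atTop (𝓝 (∫ x, inner ℂ (ψ x) (f x) ∂m)) := by
  have h' := (Lp.tendsto_Lp_iff_tendsto_eLpNorm'' u hu f hf).2 h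
  simp_rw [← inner_toLp_toLp hψ (hu _), ← inner_toLp_toLp hψ hf]
  exact tendsto_const_nhds.inner h'

end SquareIntegrable

/-! ### Test fields -/

/-- The curl read off from the derivative of a vector field. -/
noncomputable def curlOfDeriv (A : R3 →L[ℝ] C3) : C3 :=
  !₂[A (EuclideanSpace.single 1 1) 2 - A (EuclideanSpace.single 2 1) 1,
     A (EuclideanSpace.single 2 1) 0 - A (EuclideanSpace.single 0 1) 2,
     A (EuclideanSpace.single 0 1) 1 - A (EuclideanSpace.single 1 1) 0]

lemma smoothCurl_eq_comp (φ : R3 → C3) : smoothCurl φ = curlOfDeriv ∘ fderiv ℝ φ := rfl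

lemma continuous_curlOfDeriv : Continuous curlOfDeriv := by
  unfold curlOfDeriv
  refine (PiLp.continuous_toLp 2 _).comp ?_
  refine continuous_pi fun i => ?_
  fin_cases i <;> simp <;> fun_prop

lemma curlOfDeriv_zero : curlOfDeriv 0 = 0 := by
  ext i
  fin_cases i <;> simp [curlOfDeriv]

lemma IsTestField.memLp {U : Set R3} {φ : R3 → C3} (h : IsTestField U φ) (m : Measure R3)
    [IsFiniteMeasureOnCompacts m] : MemLp φ 2 m :=
  h.1.continuous.memLp_of_hasCompactSupport h.2.1

lemma IsTestField.memLp_smoothCurl {U : Set R3} {φ : R3 → C3} (h : IsTestField U φ)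
    (m : Measure R3) [IsFiniteMeasureOnCompacts m] : MemLp (smoothCurl φ) 2 m := by
  rw [smoothCurl_eq_comp]
  refine Continuous.memLp_of_hasCompactSupport ?_ ?_
  · exact continuous_curlOfDeriv.comp (h.1.continuous_fderiv (by simp))
  · exact (h.2.1.fderiv ℝ).comp_left curlOfDeriv_zero

lemma isTestField_smul_const {U : Set R3} {g : R3 → ℝ} (hg : ContDiff ℝ (⊤ : ℕ∞) g)
    (hgc : HasCompactSupport g) (hgU : tsupport g ⊆ U) (c : C3) :
    IsTestField U (fun x => g x • c) := by
  refine ⟨hg.smul contDiff_const, hgc.smul_right, (closure_mono ?_).trans hgU⟩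
  exact Function.support_smul_subset_left g fun _ => c

/-- A square-integrable field on an open set is determined by its pairings with test fields. -/
lemma ae_eq_zero_of_forall_testField {U : Set R3} (hU : IsOpen U) {m : Measure R3}
    [IsFiniteMeasureOnCompacts m] {t : R3 → C3} (ht : MemLp t 2 m)
    (h : ∀ φ, IsTestField U φ → ∫ x, inner ℂ (φ x) (t x) ∂m = 0) :
    ∀ᵐ x ∂m, x ∈ U → t x = 0 := by
  have hloc : LocallyIntegrable t m := ht.locallyIntegrable (by norm_num)
  refine hU.ae_eq_zero_of_integral_contDiff_smul_eq_zero (hloc.locallyIntegrableOn U) ?_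
  intro g hg hgc hgU
  have hint : Integrable (fun x => g x • t x) m :=
    hloc.integrable_smul_left_of_hasCompactSupport hg.continuous hgc
  -- Scalar test functions suffice: since `g` is real, it moves across the inner product, and
  -- pairing `g • t` with `c` is the same as pairing `t` with the test field `g • c`.
  refine ext_inner_left ℂ fun c => ?_
  rw [inner_zero_right, ← integral_inner hint, ← h _ (isTestField_smul_const hg hgc hgU c)]
  refine integral_congr_ae (.of_forall fun x => ?_)
  simp only [inner_smul_right_eq_smul, inner_smul_left_eq_smul]

/-! ### Green's formula -/

section Green

/-- Green's formula on `D` for `u` with curl `w` and trace `t`, square-integrable for `m`. -/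
def IsGreen (D U : Set R3) (m : Measure R3) (u w t : R3 → C3) : Prop :=
  ∀ φ, IsTestField U φ →
    ∫ x in D, (inner ℂ (φ x) (w x) - inner ℂ (smoothCurl φ x) (u x)) =
      ∫ x, inner ℂ (φ x) (t x) ∂m

variable {D U : Set R3} {m : Measure R3} {u u' w w' t t' : R3 → C3}

lemma isGreen_zero : IsGreen D U m 0 0 0 := by
  intro φ _
  simp

lemma IsGreen.congr (h : IsGreen D U m u w t) (hu : u =ᵐ[volume.restrict D] u')
    (hw : w =ᵐ[volume.restrict D] w') (ht : t =ᵐ[m] t') : IsGreen D U m u' w' t' := by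
  intro φ hφ
  have e : ∫ x, inner ℂ (φ x) (t x) ∂m = ∫ x, inner ℂ (φ x) (t' x) ∂m := by
    refine integral_congr_ae ?_
    filter_upwards [ht] with x hx
    rw [hx]
  rw [← e, ← h φ hφ]
  refine integral_congr_ae ?_
  filter_upwards [hu, hw] with x h1 h2
  rw [h1, h2]

lemma IsGreen.smul (h : IsGreen D U m u w t) (c : ℂ) :
    IsGreen D U m (c • u) (c • w) (c • t) := by
  intro φ hφ
  simp only [Pi.smul_apply, inner_smul_right, ← mul_sub, integral_const_mul, h φ hφ]

/-- With the zero measure on the surface the boundary term disappears, so linearity and closedness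
proved for `IsGreen` serve weak curls and traces alike. -/
lemma isWeakCurl_iff_isGreen {Ω : Set R3} (hu : MemLp u 2 (volume.restrict Ω))
    (hw : MemLp w 2 (volume.restrict Ω)) : IsWeakCurl Ω u w ↔ IsGreen Ω Ω 0 u w 0 := by
  refine forall₂_congr fun φ hφ => ?_
  rw [integral_sub (memLp_integrable_inner (hφ.memLp _) hw)
    (memLp_integrable_inner (hφ.memLp_smoothCurl _) hu), integral_zero_measure, sub_eq_zero]

variable [IsFiniteMeasureOnCompacts m]

lemma IsGreen.add (h : IsGreen D U m u w t) (h' : IsGreen D U m u' w' t')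
    (hu : MemLp u 2 (volume.restrict D)) (hu' : MemLp u' 2 (volume.restrict D))
    (hw : MemLp w 2 (volume.restrict D)) (hw' : MemLp w' 2 (volume.restrict D))
    (ht : MemLp t 2 m) (ht' : MemLp t' 2 m) :
    IsGreen D U m (u + u') (w + w') (t + t') := by
  intro φ hφ
  have i1 := memLp_integrable_inner (hφ.memLp _) hw
  have i1' := memLp_integrable_inner (hφ.memLp _) hw'
  have i2 := memLp_integrable_inner (hφ.memLp_smoothCurl _) hu
  have i2' := memLp_integrable_inner (hφ.memLp_smoothCurl _) hu'
  have i3 := memLp_integrable_inner (hφ.memLp _) ht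
  have i3' := memLp_integrable_inner (hφ.memLp _) ht'
  simp only [Pi.add_apply, inner_add_right]
  rw [integral_add i3 i3', ← h φ hφ, ← h' φ hφ]
  refine Eq.trans ?_ (integral_add (i1.sub i2) (i1'.sub i2'))
  congr 1 with x
  ring

/-- The trace in Green's formula is unique. -/
lemma IsGreen.ae_eq (hU : IsOpen U) (h : IsGreen D U m u w t) (h' : IsGreen D U m u w t')
    (ht : MemLp t 2 m) (ht' : MemLp t' 2 m) : ∀ᵐ x ∂m, x ∈ U → t x = t' x := by
  have := ae_eq_zero_of_forall_testField hU (ht.sub ht') (fun φ hφ => by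
    simp only [Pi.sub_apply, inner_sub_right]
    rw [integral_sub (memLp_integrable_inner (hφ.memLp _) ht)
      (memLp_integrable_inner (hφ.memLp _) ht'), ← h φ hφ, ← h' φ hφ, sub_self])
  filter_upwards [this] with x hx hxU using sub_eq_zero.1 (hx hxU)

lemma IsGreen.of_tendsto {un wn tn : ℕ → R3 → C3} (h : ∀ n, IsGreen D U m (un n) (wn n) (tn n))
    (hun : ∀ n, MemLp (un n) 2 (volume.restrict D)) (hu : MemLp u 2 (volume.restrict D))
    (hwn : ∀ n, MemLp (wn n) 2 (volume.restrict D)) (hw : MemLp w 2 (volume.restrict D))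
    (htn : ∀ n, MemLp (tn n) 2 m) (ht : MemLp t 2 m)
    (hu' : Tendsto (fun n => eLpNorm (un n - u) 2 (volume.restrict D)) atTop (𝓝 0))
    (hw' : Tendsto (fun n => eLpNorm (wn n - w) 2 (volume.restrict D)) atTop (𝓝 0))
    (ht' : Tendsto (fun n => eLpNorm (tn n - t) 2 m) atTop (𝓝 0)) :
    IsGreen D U m u w t := by
  intro φ hφ
  have key : ∀ {a b : R3 → C3}, MemLp a 2 (volume.restrict D) → MemLp b 2 (volume.restrict D) →
      ∫ x in D, (inner ℂ (φ x) (b x) - inner ℂ (smoothCurl φ x) (a x)) =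
      (∫ x in D, inner ℂ (φ x) (b x)) - ∫ x in D, inner ℂ (smoothCurl φ x) (a x) :=
    fun ha hb => integral_sub (memLp_integrable_inner (hφ.memLp _) hb)
      (memLp_integrable_inner (hφ.memLp_smoothCurl _) ha)
  rw [key hu hw]
  refine tendsto_nhds_unique ((tendsto_integral_inner (hφ.memLp _) hwn hw hw').sub
    (tendsto_integral_inner (hφ.memLp_smoothCurl _) hun hu hu')) ?_
  refine (tendsto_integral_inner (hφ.memLp _) htn ht ht').congr fun n => ?_
  rw [← key (hun n) (hwn n), h n φ hφ]

/-- The weak curl is unique. -/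
lemma IsWeakCurl.ae_eq {Ω : Set R3} (hΩ : IsOpen Ω) (h : IsWeakCurl Ω u w)
    (h' : IsWeakCurl Ω u w') (hw : MemLp w 2 (volume.restrict Ω))
    (hw' : MemLp w' 2 (volume.restrict Ω)) : w =ᵐ[volume.restrict Ω] w' := by
  have := ae_eq_zero_of_forall_testField hΩ (hw.sub hw') (fun φ hφ => by
    simp only [Pi.sub_apply, inner_sub_right]
    rw [integral_sub (memLp_integrable_inner (hφ.memLp _) hw)
      (memLp_integrable_inner (hφ.memLp _) hw'), h φ hφ, h' φ hφ, sub_self])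
  filter_upwards [this, ae_restrict_mem hΩ.measurableSet] with x hx hxU
  exact sub_eq_zero.1 (hx hxU)

end Green

/-! ### Tangential traces -/

/-- The cross product with a real vector as a linear map. -/
noncomputable def crossCL (n : R3) : C3 →L[ℂ] C3 :=
  LinearMap.toContinuousLinearMap
    { toFun := crossC n
      map_add' := fun a b => by
        ext i; fin_cases i <;> simp [crossC, cross_apply] <;> ring
      map_smul' := fun c a => by
        ext i; fin_cases i <;> simp [crossC, cross_apply] <;> ring }

lemma norm_crossC_le {n : R3} (hn : ‖n‖ ≤ 1) (a : C3) : ‖crossC n a‖ ≤ 4 * ‖a‖ := by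
  have hni : ∀ i, ‖((n i : ℝ) : ℂ)‖ ≤ 1 := fun i => by
    rw [Complex.norm_real]; exact (PiLp.norm_apply_le n i).trans hn
  have hai : ∀ i, ‖a i‖ ≤ ‖a‖ := fun i => PiLp.norm_apply_le a i
  have key : ∀ i j k l, ‖((n i : ℝ) : ℂ) * a j - ((n k : ℝ) : ℂ) * a l‖ ≤ 2 * ‖a‖ := by
    intro i j k l
    have h : ∀ i j, ‖((n i : ℝ) : ℂ) * a j‖ ≤ ‖a‖ := fun i j => by
      rw [norm_mul]
      exact (mul_le_mul (hni i) (hai j) (norm_nonneg _) zero_le_one).trans_eq (one_mul _)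
    exact (norm_sub_le _ _).trans (by linarith [h i j, h k l])
  -- Each of the three components is at most `2 * ‖a‖`, so the squares add up to at most `12 * ‖a‖ ^
  -- 2`; the constant 4 is not sharp.
  refine le_of_sq_le_sq ?_ (by positivity)
  rw [EuclideanSpace.norm_sq_eq, Fin.sum_univ_three]
  have h0 := pow_le_pow_left₀ (norm_nonneg _) (key 1 2 2 1) 2
  have h1 := pow_le_pow_left₀ (norm_nonneg _) (key 2 0 0 2) 2
  have h2 := pow_le_pow_left₀ (norm_nonneg _) (key 0 1 1 0) 2
  simp only [crossC, cross_apply, Matrix.cons_val_zero, Matrix.cons_val_one, Matrix.cons_val]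
  nlinarith [sq_nonneg ‖a‖]

section Trace

variable {D U Λ : Set R3} {ν : R3 → R3} {u u' w w' g g' : R3 → C3}

lemma isTangentialTrace_iff : IsTangentialTrace D U Λ ν u w g ↔
    ∃ t : R3 → C3, MemLp t 2 ((μHE[2] : Measure R3).restrict Λ) ∧
      IsGreen D U ((μHE[2] : Measure R3).restrict Λ) u w t ∧
      (∀ᵐ x ∂(μHE[2] : Measure R3).restrict Λ,
        g x = -crossCL (ν x) (t x) ∧ t x = crossCL (ν x) (g x)) := Iff.rfl

lemma isTangentialTrace_zero : IsTangentialTrace D U Λ ν 0 0 0 :=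
  isTangentialTrace_iff.2 ⟨0, MemLp.zero, isGreen_zero, .of_forall fun x => by simp⟩

lemma IsTangentialTrace.congr (h : IsTangentialTrace D U Λ ν u w g)
    (hu : u =ᵐ[volume.restrict D] u') (hw : w =ᵐ[volume.restrict D] w')
    (hg : g =ᵐ[(μHE[2] : Measure R3).restrict Λ] g') : IsTangentialTrace D U Λ ν u' w' g' := by
  obtain ⟨t, ht, hG, hx⟩ := isTangentialTrace_iff.1 h
  refine isTangentialTrace_iff.2 ⟨t, ht, hG.congr hu hw ae_eq_rfl, ?_⟩
  filter_upwards [hx, hg] with x h1 h2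
  rwa [← h2]

lemma IsTangentialTrace.smul (h : IsTangentialTrace D U Λ ν u w g) (c : ℂ) :
    IsTangentialTrace D U Λ ν (c • u) (c • w) (c • g) := by
  obtain ⟨t, ht, hG, hx⟩ := isTangentialTrace_iff.1 h
  refine isTangentialTrace_iff.2 ⟨c • t, ht.const_smul c, hG.smul c, ?_⟩
  filter_upwards [hx] with x hx
  simp only [Pi.smul_apply, map_smul, ← hx.2]
  rw [← smul_neg, ← hx.1]
  exact ⟨rfl, trivial⟩

/-- The surface measure of `Λ` is finite. -/
def HasFiniteArea (Λ : Set R3) : Prop := (μHE[2] : Measure R3) Λ < ⊤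

/-- Two-dimensional Hausdorff measure is not locally finite on `R3`. Only after restriction to a set
of finite area are test fields square integrable, and traces locally integrable, for the surface
measure. -/
lemma HasFiniteArea.isFiniteMeasure (h : HasFiniteArea Λ) :
    IsFiniteMeasure ((μHE[2] : Measure R3).restrict Λ) := isFiniteMeasure_restrict.2 h.ne

lemma IsTangentialTrace.add (hΛ : HasFiniteArea Λ) (h : IsTangentialTrace D U Λ ν u w g)
    (h' : IsTangentialTrace D U Λ ν u' w' g')
    (hu : MemLp u 2 (volume.restrict D)) (hu' : MemLp u' 2 (volume.restrict D))
    (hw : MemLp w 2 (volume.restrict D)) (hw' : MemLp w' 2 (volume.restrict D)) :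
    IsTangentialTrace D U Λ ν (u + u') (w + w') (g + g') := by
  have := hΛ.isFiniteMeasure
  obtain ⟨t, ht, hG, hx⟩ := isTangentialTrace_iff.1 h
  obtain ⟨t', ht', hG', hx'⟩ := isTangentialTrace_iff.1 h'
  refine isTangentialTrace_iff.2 ⟨t + t', ht.add ht', hG.add hG' hu hu' hw hw' ht ht', ?_⟩
  filter_upwards [hx, hx'] with x hx hx'
  simp only [Pi.add_apply, map_add, ← hx.2, ← hx'.2]
  rw [neg_add, ← hx.1, ← hx'.1]
  exact ⟨rfl, trivial⟩

/-- Tangential traces on a hypersurface inside `U` are unique. -/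
lemma IsTangentialTrace.ae_eq (hΛ : HasFiniteArea Λ) (hU : IsOpen U)
    (hΛU : ∀ᵐ x ∂(μHE[2] : Measure R3).restrict Λ, x ∈ U)
    (h : IsTangentialTrace D U Λ ν u w g) (h' : IsTangentialTrace D U Λ ν u w g') :
    g =ᵐ[(μHE[2] : Measure R3).restrict Λ] g' := by
  have := hΛ.isFiniteMeasure
  obtain ⟨t, ht, hG, hx⟩ := isTangentialTrace_iff.1 h
  obtain ⟨t', ht', hG', hx'⟩ := isTangentialTrace_iff.1 h'
  filter_upwards [hx, hx', hG.ae_eq hU hG' ht ht', hΛU] with x hx hx' h1 h2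
  rw [hx.1, hx'.1, h1 h2]

/-- Tangential traces are stable under convergence in `L²`. -/
lemma IsTangentialTrace.of_tendsto {un wn gn : ℕ → R3 → C3} (hΛ : HasFiniteArea Λ)
    (hν : ∀ x, ‖ν x‖ ≤ 1) (h : ∀ n, IsTangentialTrace D U Λ ν (un n) (wn n) (gn n))
    (hun : ∀ n, MemLp (un n) 2 (volume.restrict D)) (hu : MemLp u 2 (volume.restrict D))
    (hwn : ∀ n, MemLp (wn n) 2 (volume.restrict D)) (hw : MemLp w 2 (volume.restrict D))
    (hgn : ∀ n, MemLp (gn n) 2 ((μHE[2] : Measure R3).restrict Λ))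
    (hg : MemLp g 2 ((μHE[2] : Measure R3).restrict Λ))
    (hu' : Tendsto (fun n => eLpNorm (un n - u) 2 (volume.restrict D)) atTop (𝓝 0))
    (hw' : Tendsto (fun n => eLpNorm (wn n - w) 2 (volume.restrict D)) atTop (𝓝 0))
    (hg' : Tendsto (fun n => eLpNorm (gn n - g) 2 ((μHE[2] : Measure R3).restrict Λ))
      atTop (𝓝 0)) :
    IsTangentialTrace D U Λ ν u w g := by
  have := hΛ.isFiniteMeasure
  choose t ht hG hx using fun n => isTangentialTrace_iff.1 (h n)
  have hx' := ae_all_iff.2 hx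
  -- An almost everywhere convergent subsequence serves twice: it carries the pointwise
  -- cross-product relations to the limit, and it shows that `ν × g` is measurable without any
  -- measurability of `ν`.
  obtain ⟨ns, -, hns⟩ := (tendstoInMeasure_of_tendsto_eLpNorm two_ne_zero
    (fun n => (hgn n).1) hg.1 hg').exists_seq_tendsto_ae
  have hlim : ∀ᵐ x ∂(μHE[2] : Measure R3).restrict Λ,
      Tendsto (fun i => t (ns i) x) atTop (𝓝 (crossCL (ν x) (g x))) := by
    filter_upwards [hx', hns] with x h1 h2
    simp only [(h1 _).2]
    exact ((crossCL (ν x)).continuous.tendsto _).comp h2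
  have hT : MemLp (fun x => crossCL (ν x) (g x)) 2 ((μHE[2] : Measure R3).restrict Λ) :=
    hg.of_le_mul (aestronglyMeasurable_of_tendsto_ae atTop (fun i => (ht (ns i)).1) hlim)
      (.of_forall fun x => norm_crossC_le (hν x) (g x))
  refine isTangentialTrace_iff.2 ⟨_, hT, ?_, ?_⟩
  -- Since `t n = ν × gn n` with `‖ν‖ ≤ 1`, convergence of the tangential traces forces convergence
  -- of the Green traces.
  · refine IsGreen.of_tendsto hG hun hu hwn hw ht hT hu' hw' ?_
    have hle : ∀ n, eLpNorm (t n - fun x => crossCL (ν x) (g x)) 2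
        ((μHE[2] : Measure R3).restrict Λ) ≤
        ENNReal.ofReal 4 * eLpNorm (gn n - g) 2 ((μHE[2] : Measure R3).restrict Λ) := by
      intro n
      refine eLpNorm_le_mul_eLpNorm_of_ae_le_mul ?_ 2
      filter_upwards [hx n] with x hx
      rw [Pi.sub_apply, hx.2, ← map_sub]
      exact norm_crossC_le (hν x) _
    refine tendsto_of_tendsto_of_tendsto_of_le_of_le tendsto_const_nhds ?_
      (fun _ => zero_le) hle
    simpa using ENNReal.Tendsto.const_mul (a := ENNReal.ofReal 4) hg' (.inr ENNReal.ofReal_ne_top)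
  · filter_upwards [hx', hns, hlim] with x h1 h2 h3
    refine ⟨tendsto_nhds_unique h2 ?_, rfl⟩
    simp only [(h1 _).1]
    exact (((crossCL (ν x)).continuous.tendsto _).comp h3).neg

end Trace

lemma norm_outerNormal_le (D : Set R3) (x : R3) : ‖outerNormal D x‖ ≤ 1 := by
  unfold outerNormal
  split_ifs with h
  · exact h.choose_spec.1.le
  · simp

/-! ### Finite surface area -/

lemma HasFiniteArea.mono {A B : Set R3} (h : A ⊆ B) (hB : HasFiniteArea B) : HasFiniteArea A :=
  (measure_mono h).trans_lt hB

lemma HasFiniteArea.union {A B : Set R3} (hA : HasFiniteArea A) (hB : HasFiniteArea B) :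
    HasFiniteArea (A ∪ B) :=
  (measure_union_le A B).trans_lt (ENNReal.add_lt_top.2 ⟨hA, hB⟩)

/-- Lipschitz maps enlarge Hausdorff measure by at most a constant factor, and in the plane that
measure is Lebesgue measure. The Euclidean normalisation only adds a finite factor. -/
lemma hasFiniteArea_image {K : NNReal} {f : ℝ × ℝ → R3} (hf : LipschitzWith K f)
    {B : Set (ℝ × ℝ)} (hB : Bornology.IsBounded B) : HasFiniteArea (f '' B) := by
  have h1 : (μH[2] : Measure R3) (f '' B) < ⊤ := by
    refine (hf.hausdorffMeasure_image_le zero_le_two B).trans_lt ?_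
    rw [hausdorffMeasure_prod_real]
    exact ENNReal.mul_lt_top (ENNReal.rpow_lt_top_of_nonneg zero_le_two ENNReal.coe_ne_top)
      hB.measure_lt_top
  have h2 : (μH[((2 : ℕ) : ℝ)] : Measure R3) (f '' B) < ⊤ := by rwa [Nat.cast_ofNat]
  unfold HasFiniteArea
  rw [Measure.euclideanHausdorffMeasure_def, Measure.smul_apply, ENNReal.smul_def, smul_eq_mul]
  exact ENNReal.mul_lt_top ENNReal.coe_lt_top h2

/-- The projection to the first two coordinates. -/
noncomputable def horizontal (x : R3) : R2 := !₂[x 0, x 1]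

lemma continuous_horizontal : Continuous horizontal := by
  refine (PiLp.continuous_toLp 2 _).comp ?_
  refine continuous_pi fun i => ?_
  fin_cases i <;> simp <;> fun_prop

lemma continuous_coord (i : Fin 3) : Continuous fun x : R3 => x i := by fun_prop

lemma prism_eq (S : Set R2) (L : ℝ) :
    prism S L = horizontal ⁻¹' S ∩ (fun x : R3 => x 2) ⁻¹' Ioo (-L) L := rfl

lemma isOpen_prism {S : Set R2} (hS : IsOpen S) (L : ℝ) : IsOpen (prism S L) :=
  (hS.preimage continuous_horizontal).inter (isOpen_Ioo.preimage (continuous_coord 2))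

lemma lipschitz_toLp3 {K : NNReal} {f : ℝ × ℝ → Fin 3 → ℝ}
    (hf : ∀ i, LipschitzWith K fun p => f p i) :
    ∃ K', LipschitzWith K' fun p => (WithLp.toLp 2 (f p) : R3) := by
  have h : LipschitzWith K f := lipschitzWith_iff_dist_le_mul.2 fun p q =>
    (dist_pi_le_iff (by positivity)).2 fun i => (hf i).dist_le_mul p q
  exact ⟨_, (PiLp.lipschitzWith_toLp 2 (fun _ : Fin 3 => ℝ)).comp h⟩

lemma hasFiniteArea_horizontal {S : Set R2} (hS : Bornology.IsBounded S) (t : ℝ) :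
    HasFiniteArea {x | horizontal x ∈ S ∧ x 2 = t} := by
  obtain ⟨R, hR⟩ := hS.subset_closedBall 0
  obtain ⟨K, hK⟩ := lipschitz_toLp3 (K := 1) (f := fun p => ![p.1, p.2, t]) (by
    intro i
    fin_cases i
    · exact LipschitzWith.prod_fst
    · exact LipschitzWith.prod_snd
    · exact (LipschitzWith.const t).weaken zero_le_one)
  refine (hasFiniteArea_image hK (Metric.isBounded_closedBall (x := 0) (r := R))).mono ?_
  rintro x ⟨hx, hxt⟩
  refine ⟨(x 0, x 1), ?_, ?_⟩
  · have h := mem_closedBall_zero_iff.1 (hR hx)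
    rw [mem_closedBall_zero_iff, Prod.norm_def]
    exact max_le ((PiLp.norm_apply_le (horizontal x) 0).trans h)
      ((PiLp.norm_apply_le (horizontal x) 1).trans h)
  · ext i
    fin_cases i
    · rfl
    · rfl
    · exact hxt.symm

lemma hasFiniteArea_sheet {S : Set R2} (hS : Bornology.IsBounded S) (t : ℝ) :
    HasFiniteArea (sheet S t) := hasFiniteArea_horizontal hS t

/-- Near a boundary point of a Lipschitz set, the boundary lies on the graph. -/
lemma IsBoundedLipschitz.frontier_subset_graph {S : Set R2} {p : R2} {e : R2 ≃ₗᵢ[ℝ] R2}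
    {h : ℝ → ℝ} {r : ℝ} (hh : Continuous h)
    (hS : ∀ x ∈ Metric.ball p r, x ∈ S ↔ (e (x - p)) 1 < h ((e (x - p)) 0)) {x : R2}
    (hx : x ∈ frontier S) (hxr : x ∈ Metric.ball p r) : (e (x - p)) 1 = h ((e (x - p)) 0) := by
  have hball : Metric.ball p r ∈ 𝓝 x := Metric.isOpen_ball.mem_nhds hxr
  have c1 : Continuous fun y : R2 => (e (y - p)) 1 := by fun_prop
  have c2 : Continuous fun y : R2 => h ((e (y - p)) 0) := by fun_prop
  rcases lt_trichotomy ((e (x - p)) 1) (h ((e (x - p)) 0)) with hlt | heq | hgt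
  · refine absurd (mem_interior_iff_mem_nhds.2 ?_) hx.2
    filter_upwards [hball, (isOpen_lt c1 c2).mem_nhds hlt] with y hy hy'
    exact (hS y hy).2 hy'
  · exact heq
  · have : ∀ᶠ y in 𝓝 x, y ∉ S := by
      filter_upwards [hball, (isOpen_lt c2 c1).mem_nhds hgt] with y hy hy' hyS
      exact lt_asymm ((hS y hy).1 hyS) hy'
    obtain ⟨y, hy, hy'⟩ := (this.and_frequently (mem_closure_iff_frequently.1 hx.1)).exists
    exact absurd hy' hy

/-- By compactness finitely many charts cover the boundary curve. Over each chart the lateral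
surface lies in the Lipschitz image of a rectangle: graph parameter times height. -/
lemma IsBoundedLipschitz.hasFiniteArea_lateral {S : Set R2} (hS : IsBoundedLipschitz S) (L : ℝ) :
    HasFiniteArea {x | horizontal x ∈ frontier S ∧ x 2 ∈ Icc (-L) L} := by
  have hc : IsCompact (frontier S) :=
    Metric.isCompact_of_isClosed_isBounded isClosed_frontier
      (hS.isBounded.closure.subset frontier_subset_closure)
  -- Doubling the frontier lets the compactness induction vary the second copy over arbitrary sets
  -- while the first keeps the points on the curve.
  suffices H : HasFiniteArea {x | horizontal x ∈ frontier S ∩ frontier S ∧ x 2 ∈ Icc (-L) L} by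
    simpa using H
  refine hc.induction_on
    (p := fun A => HasFiniteArea {x | horizontal x ∈ frontier S ∩ A ∧ x 2 ∈ Icc (-L) L}) ?_ ?_ ?_ ?_
  · simp [HasFiniteArea]
  · intro A B hAB hB
    refine hB.mono ?_
    rintro x ⟨⟨h1, h2⟩, h3⟩
    exact ⟨⟨h1, hAB h2⟩, h3⟩
  · refine fun A B hA hB => (hA.union hB).mono ?_
    rintro x ⟨⟨h1, h2 | h2⟩, h3⟩
    · exact .inl ⟨⟨h1, h2⟩, h3⟩
    · exact .inr ⟨⟨h1, h2⟩, h3⟩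
  · intro p hp
    obtain ⟨e, K, h, r, hr, hh, hchart⟩ := hS.chart p hp
    refine ⟨_, mem_nhdsWithin_of_mem_nhds (Metric.ball_mem_nhds p hr), ?_⟩
    have hgraph : ∃ K', LipschitzWith K' fun s : ℝ => (WithLp.toLp 2 ![s, h s] : R2) := by
      have : LipschitzWith (max 1 K) fun s : ℝ => ![s, h s] :=
        lipschitzWith_iff_dist_le_mul.2 fun s s' =>
          (dist_pi_le_iff (by positivity)).2 fun i => by
            fin_cases i
            · exact (LipschitzWith.id.weaken (le_max_left 1 K)).dist_le_mul s s'
            · exact (hh.weaken (le_max_right 1 K)).dist_le_mul s s'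
      exact ⟨_, (PiLp.lipschitzWith_toLp 2 (fun _ : Fin 2 => ℝ)).comp this⟩
    obtain ⟨K', hK'⟩ := hgraph
    have hγ : LipschitzWith K' fun s : ℝ => e.symm (WithLp.toLp 2 ![s, h s]) + p := by
      refine lipschitzWith_iff_dist_le_mul.2 fun s s' => ?_
      rw [dist_add_right, e.symm.dist_map]
      exact hK'.dist_le_mul s s'
    have hγi : ∀ i, LipschitzWith K' fun s : ℝ => (e.symm (WithLp.toLp 2 ![s, h s]) + p) i :=
      fun i => lipschitzWith_iff_dist_le_mul.2 fun s s' =>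
        (PiLp.dist_apply_le _ _ i).trans (hγ.dist_le_mul s s')
    obtain ⟨K'', hK''⟩ := lipschitz_toLp3 (K := max K' 1)
      (f := fun q => ![(e.symm (WithLp.toLp 2 ![q.1, h q.1]) + p) 0,
        (e.symm (WithLp.toLp 2 ![q.1, h q.1]) + p) 1, q.2]) (by
      intro i
      fin_cases i
      · exact (((hγi 0).comp LipschitzWith.prod_fst).weaken (by simp))
      · exact (((hγi 1).comp LipschitzWith.prod_fst).weaken (by simp))
      · exact LipschitzWith.prod_snd.weaken (le_max_right _ _))
    refine (hasFiniteArea_image hK''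
      ((Metric.isBounded_closedBall (x := (0 : ℝ)) (r := r)).prod
        (Metric.isBounded_Icc (-L) L))).mono ?_
    rintro x ⟨⟨hx, hxr⟩, hxL⟩
    have hg := frontier_subset_graph hh.continuous hchart hx hxr
    have hpt : e.symm (WithLp.toLp 2 ![(e (horizontal x - p)) 0, h ((e (horizontal x - p)) 0)]) + p
        = horizontal x := by
      have : (WithLp.toLp 2 ![(e (horizontal x - p)) 0, h ((e (horizontal x - p)) 0)] : R2)
          = e (horizontal x - p) := by
        ext i
        fin_cases i
        · rfl
        · exact hg.symm
      rw [this, e.symm_apply_apply, sub_add_cancel]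
    refine ⟨((e (horizontal x - p)) 0, x 2), ⟨?_, hxL⟩, ?_⟩
    -- The chart is centred at `p` and isometric, so the graph parameter is bounded by the distance
    -- to `p`, hence by `r`.
    · rw [mem_closedBall_zero_iff]
      refine (PiLp.norm_apply_le (e (horizontal x - p)) 0).trans ?_
      rw [e.norm_map, ← dist_eq_norm]
      exact (Metric.mem_ball.1 hxr).le
    · simp only [hpt]
      ext i
      fin_cases i <;> rfl

lemma IsBoundedLipschitz.hasFiniteArea_frontier {S : Set R2} (hS : IsBoundedLipschitz S) {L : ℝ}
    (hL : 0 < L) : HasFiniteArea (frontier (prism S L)) := by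
  have hL' : -L ≠ L := by linarith
  refine ((hS.hasFiniteArea_lateral L).union
    ((hasFiniteArea_horizontal hS.isBounded.closure (-L)).union
      (hasFiniteArea_horizontal hS.isBounded.closure L))).mono ?_
  rw [prism_eq]
  intro x hx
  rcases frontier_inter_subset _ _ hx with ⟨h1, h2⟩ | ⟨h1, h2⟩
  · refine .inl ⟨continuous_horizontal.frontier_preimage_subset S h1, ?_⟩
    have := (continuous_coord 2).closure_preimage_subset _ h2
    rwa [closure_Ioo hL'] at this
  · have h3 := (continuous_coord 2).frontier_preimage_subset _ h2
    rw [frontier_Ioo (by linarith)] at h3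
    have h4 : horizontal x ∈ closure S := continuous_horizontal.closure_preimage_subset _ h1
    rcases h3 with h3 | h3
    · exact .inr (.inl ⟨h4, h3⟩)
    · exact .inr (.inr ⟨h4, h3⟩)

lemma sheet_subset_prism {S : Set R2} {L d : ℝ} (hd : 0 < d) {k : ℤ} (hk : k ∈ sheetIndices L d) :
    sheet S (k * d) ⊆ prism S L := by
  rintro x ⟨h1, h2⟩
  have h3 : (k : ℝ) * d ∈ Ioo (-L) (L - d) := hk
  exact ⟨h1, by rw [h2]; exact ⟨h3.1, by linarith [h3.2]⟩⟩

lemma sheet_subset_sheets {S : Set R2} {L d : ℝ} {k : ℤ} (hk : k ∈ sheetIndices L d) :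
    sheet S (k * d) ⊆ sheets S L d := subset_biUnion_of_mem (u := fun k : ℤ => sheet S (k * d)) hk

lemma measurableSet_sheet {S : Set R2} (hS : IsOpen S) (t : ℝ) : MeasurableSet (sheet S t) :=
  (hS.preimage continuous_horizontal).measurableSet.inter
    (isClosed_singleton.preimage (continuous_coord 2)).measurableSet

lemma measurableSet_sheets {S : Set R2} (hS : IsOpen S) (L d : ℝ) :
    MeasurableSet (sheets S L d) :=
  .biUnion (Set.to_countable _) fun _ _ => measurableSet_sheet hS _

/-! ### The Lax–Milgram lemma on a closed subspace -/

section LaxMilgram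

variable {E F : Type*} [NormedAddCommGroup E] [InnerProductSpace ℂ E]
  [NormedAddCommGroup F] [InnerProductSpace ℂ F]

/-- Compressing `M` to `G` by the orthogonal projection gives a coercive, hence invertible, operator
on `G`; the variational equation says that it sends `e` to the projection of `b`. -/
theorem existsUnique_of_coercive (G : Submodule ℂ E) [CompleteSpace G] (M : E →L[ℂ] E) {c : ℝ}
    (hc : 0 < c) (hM : ∀ x ∈ G, c * ‖x‖ ^ 2 ≤ ‖inner ℂ x (M x)‖) (b : E) :
    ∃! e : E, e ∈ G ∧ ∀ v ∈ G, inner ℂ v (M e) = inner ℂ v b := by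
  set A : G →L[ℂ] G := G.orthogonalProjectionOnto ∘L M ∘L G.subtypeL with hA
  have hAi : ∀ u v : G, inner ℂ v (A u) = inner ℂ (v : E) (M u) := fun u v =>
    Submodule.inner_orthogonalProjectionOnto_eq_of_mem_left v (M u)
  have hunit : IsUnit A := by
    refine A.isUnit_of_forall_le_norm_inner_map (c := ⟨c, hc.le⟩) hc fun x => ?_
    rw [norm_inner_symm, hAi, mul_comm]
    exact hM x x.2
  obtain ⟨hinj, hsurj⟩ := ContinuousLinearMap.isUnit_iff_bijective.1 hunit
  have hiff : ∀ e : G, (∀ v ∈ G, inner ℂ v (M e) = inner ℂ v b) ↔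
      A e = G.orthogonalProjectionOnto b := by
    intro e
    constructor
    · intro h
      refine ext_inner_left ℂ fun v => ?_
      rw [hAi, Submodule.inner_orthogonalProjectionOnto_eq_of_mem_left, h v v.2]
    · intro h v hv
      rw [← hAi e ⟨v, hv⟩, h, Submodule.inner_orthogonalProjectionOnto_eq_of_mem_left]
  obtain ⟨e, he⟩ := hsurj (G.orthogonalProjectionOnto b)
  refine ⟨e, ⟨e.2, (hiff e).2 he⟩, ?_⟩
  rintro e' ⟨h1, h2⟩
  exact congrArg Subtype.val (hinj (((hiff ⟨e', h1⟩).1 h2).trans he.symm))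

/-- The diagonal operator on a Hilbert sum. -/
noncomputable def diagonalOp (A : E →L[ℂ] E) (B : F →L[ℂ] F) :
    WithLp 2 (E × F) →L[ℂ] WithLp 2 (E × F) :=
  ((WithLp.prodContinuousLinearEquiv 2 ℂ E F).symm : E × F →L[ℂ] WithLp 2 (E × F)) ∘L
    (A.prodMap B) ∘L (WithLp.prodContinuousLinearEquiv 2 ℂ E F : WithLp 2 (E × F) →L[ℂ] E × F)

lemma inner_diagonalOp (A : E →L[ℂ] E) (B : F →L[ℂ] F) (v u : WithLp 2 (E × F)) :
    inner ℂ v (diagonalOp A B u) = inner ℂ v.fst (A u.fst) + inner ℂ v.snd (B u.snd) := rfl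

lemma diagonalOp_coercive {A : E →L[ℂ] E} {B : F →L[ℂ] F} {u : WithLp 2 (E × F)} {z : ℂ} {a : ℝ}
    (hA : a * ‖u.fst‖ ^ 2 ≤ (z * inner ℂ u.fst (A u.fst)).re)
    (hB : a * ‖u.snd‖ ^ 2 ≤ (z * inner ℂ u.snd (B u.snd)).re) :
    a * ‖u‖ ^ 2 ≤ (z * inner ℂ u (diagonalOp A B u)).re := by
  rw [inner_diagonalOp, WithLp.prod_norm_sq_eq_of_L2, mul_add, mul_add, Complex.add_re]
  exact add_le_add hA hB

end LaxMilgram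

/-! ### Multiplication operators -/

section Multiplication

variable {α : Type*} [MeasurableSpace α] {m : Measure α}

/-- Multiplication by a bounded function. -/
noncomputable def mulOp (f : α → ℂ) (hf : MemLp f ⊤ m) : Lp C3 2 m →L[ℂ] Lp C3 2 m :=
  (ContinuousLinearMap.lsmul ℂ ℂ).holderL m ⊤ 2 2 hf.toLp

lemma coeFn_mulOp {f : α → ℂ} (hf : MemLp f ⊤ m) (u : Lp C3 2 m) :
    mulOp f hf u =ᵐ[m] fun x => f x • u x := by
  have h := (ContinuousLinearMap.lsmul ℂ ℂ (E := C3)).coeFn_holder (r := 2) hf.toLp u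
  filter_upwards [h, hf.coeFn_toLp] with x h1 h2
  rw [← h2]
  exact h1

lemma inner_mulOp {f : α → ℂ} (hf : MemLp f ⊤ m) (u v : Lp C3 2 m) :
    inner ℂ v (mulOp f hf u) = ∫ x, f x * inner ℂ (v x) (u x) ∂m := by
  rw [L2.inner_def]
  refine integral_congr_ae ?_
  filter_upwards [coeFn_mulOp hf u] with x hx
  rw [hx, inner_smul_right]

/-- The pointwise lower bound is integrated against `‖u x‖ ^ 2`. The slack `a ≤ b` allows one common
constant for all four blocks. -/
lemma mulOp_coercive {f : α → ℂ} (hf : MemLp f ⊤ m) (u : Lp C3 2 m) {z : ℂ} {a b : ℝ}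
    (hab : a ≤ b) (h : ∀ᵐ x ∂m, b ≤ (z * f x).re) :
    a * ‖u‖ ^ 2 ≤ (z * inner ℂ u (mulOp f hf u)).re := by
  have hi : Integrable (fun x => z * inner ℂ (u x) (mulOp f hf u x)) m :=
    (L2.integrable_inner u (mulOp f hf u)).const_mul z
  have hn : ‖u‖ ^ 2 = ∫ x, ‖u x‖ ^ 2 ∂m := by
    rw [@norm_sq_eq_re_inner ℂ, L2.inner_def, ← integral_re (L2.integrable_inner u u)]
    simp_rw [← norm_sq_eq_re_inner]
  have hre : (∫ x, z * inner ℂ (u x) (mulOp f hf u x) ∂m).re =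
      ∫ x, (z * inner ℂ (u x) (mulOp f hf u x)).re ∂m := (integral_re hi).symm
  rw [L2.inner_def, ← integral_const_mul, hre, hn, ← integral_const_mul]
  refine integral_mono_ae ?_ hi.re ?_
  · exact (((memLp_two_iff_integrable_sq_norm (Lp.memLp u).1).1 (Lp.memLp u)).const_mul a)
  · filter_upwards [h, coeFn_mulOp hf u] with x h1 h2
    rw [h2, inner_smul_right, inner_self_eq_norm_sq_to_K, ← mul_assoc]
    have : (z * f x * (((‖u x‖ : ℝ) : ℂ) ^ 2)).re = (z * f x).re * ‖u x‖ ^ 2 := by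
      rw [← Complex.ofReal_pow, Complex.re_mul_ofReal]
    exact (mul_le_mul_of_nonneg_right (hab.trans h1) (sq_nonneg _)).trans_eq this.symm

end Multiplication

/-! ### Fields together with their curls and traces -/

section Graph

variable (S : Set R2) (L d : ℝ)

/-- Quadruples of a field, its curl, its trace on the sheets and its trace on the boundary. -/
abbrev Quadruple :=
  WithLp 2 (WithLp 2 (L2 (prism S L) × L2 (prism S L)) ×
    WithLp 2 (L2Surf (sheets S L d) × L2Surf (frontier (prism S L))))

/-- The quadruple consists of a field, its curl and its traces. -/
structure IsFieldData (p : Quadruple S L d) : Prop where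
  weakCurl : IsWeakCurl (prism S L) p.fst.fst p.fst.snd
  onSheets : ∀ k ∈ sheetIndices L d,
    IsTangentialTrace (prism S L ∩ {x | x 2 < k * d}) (prism S L) (sheet S (k * d))
      (fun _ => EuclideanSpace.single 2 1) p.fst.fst p.fst.snd p.snd.fst
  onBoundary : IsTangentialTrace (prism S L) univ (frontier (prism S L)) (outerNormal (prism S L))
    p.fst.fst p.fst.snd p.snd.snd

variable {S L d}

lemma memLp_part (u : L2 (prism S L)) (A : Set R3) :
    MemLp u 2 (volume.restrict (prism S L ∩ A)) :=
  (Lp.memLp u).mono_measure (Measure.restrict_mono inter_subset_left le_rfl)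

lemma ae_part {P : R3 → Prop} (A : Set R3) (h : ∀ᵐ x ∂volume.restrict (prism S L), P x) :
    ∀ᵐ x ∂volume.restrict (prism S L ∩ A), P x :=
  ae_mono (Measure.restrict_mono inter_subset_left le_rfl) h

lemma ae_sheet {P : R3 → Prop} {k : ℤ} (hk : k ∈ sheetIndices L d)
    (h : ∀ᵐ x ∂(μHE[2] : Measure R3).restrict (sheets S L d), P x) :
    ∀ᵐ x ∂(μHE[2] : Measure R3).restrict (sheet S (k * d)), P x :=
  ae_mono (Measure.restrict_mono (sheet_subset_sheets hk) le_rfl) h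

lemma memLp_sheet {k : ℤ} (hk : k ∈ sheetIndices L d) (g : L2Surf (sheets S L d)) :
    MemLp g 2 ((μHE[2] : Measure R3).restrict (sheet S (k * d))) :=
  (Lp.memLp g).mono_measure (Measure.restrict_mono (sheet_subset_sheets hk) le_rfl)

lemma isFieldData_zero : IsFieldData S L d 0 := by
  have h0 : ∀ {α : Type} [MeasurableSpace α] (m : Measure α),
      (0 : α → C3) =ᵐ[m] ((0 : Lp C3 2 m) : α → C3) := fun m => (Lp.coeFn_zero C3 2 m).symm
  refine ⟨?_, fun k hk => ?_, ?_⟩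
  · exact (isWeakCurl_iff_isGreen (Lp.memLp _) (Lp.memLp _)).2
      (isGreen_zero.congr (h0 _) (h0 _) ae_eq_rfl)
  · exact isTangentialTrace_zero.congr (ae_part _ (h0 _)) (ae_part _ (h0 _)) (ae_sheet hk (h0 _))
  · exact isTangentialTrace_zero.congr (h0 _) (h0 _) (h0 _)

lemma IsFieldData.smul {p : Quadruple S L d} (hp : IsFieldData S L d p) (c : ℂ) :
    IsFieldData S L d (c • p) := by
  have h0 : ∀ {α : Type} [MeasurableSpace α] {m : Measure α} (f : Lp C3 2 m),
      c • (f : α → C3) =ᵐ[m] ((c • f : Lp C3 2 m) : α → C3) :=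
    fun f => (Lp.coeFn_smul c f).symm
  refine ⟨?_, fun k hk => ?_, ?_⟩
  · have h := ((isWeakCurl_iff_isGreen (Lp.memLp _) (Lp.memLp _)).1 hp.weakCurl).smul c
    rw [smul_zero] at h
    exact (isWeakCurl_iff_isGreen (Lp.memLp _) (Lp.memLp _)).2 (h.congr (h0 _) (h0 _) ae_eq_rfl)
  · exact ((hp.onSheets k hk).smul c).congr (ae_part _ (h0 _)) (ae_part _ (h0 _))
      (ae_sheet hk (h0 _))
  · exact (hp.onBoundary.smul c).congr (h0 _) (h0 _) (h0 _)

lemma IsFieldData.add (hS : IsBoundedLipschitz S) (hL : 0 < L) {p q : Quadruple S L d}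
    (hp : IsFieldData S L d p) (hq : IsFieldData S L d q) : IsFieldData S L d (p + q) := by
  have h0 : ∀ {α : Type} [MeasurableSpace α] {m : Measure α} (f g : Lp C3 2 m),
      (f : α → C3) + (g : α → C3) =ᵐ[m] ((f + g : Lp C3 2 m) : α → C3) :=
    fun f g => (Lp.coeFn_add f g).symm
  refine ⟨?_, fun k hk => ?_, ?_⟩
  · have h := ((isWeakCurl_iff_isGreen (Lp.memLp _) (Lp.memLp _)).1 hp.weakCurl).add
      ((isWeakCurl_iff_isGreen (Lp.memLp _) (Lp.memLp _)).1 hq.weakCurl)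
      (Lp.memLp _) (Lp.memLp _) (Lp.memLp _) (Lp.memLp _) MemLp.zero MemLp.zero
    rw [add_zero] at h
    exact (isWeakCurl_iff_isGreen (Lp.memLp _) (Lp.memLp _)).2
      (h.congr (h0 _ _) (h0 _ _) ae_eq_rfl)
  · exact ((hp.onSheets k hk).add (hasFiniteArea_sheet hS.isBounded _) (hq.onSheets k hk)
      (memLp_part _ _) (memLp_part _ _) (memLp_part _ _) (memLp_part _ _)).congr
      (ae_part _ (h0 _ _)) (ae_part _ (h0 _ _)) (ae_sheet hk (h0 _ _))
  · exact (hp.onBoundary.add (hS.hasFiniteArea_frontier hL) hq.onBoundary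
      (Lp.memLp _) (Lp.memLp _) (Lp.memLp _) (Lp.memLp _)).congr (h0 _ _) (h0 _ _) (h0 _ _)

/-- The space of fields together with their curls and traces. -/
def fieldSpace (hS : IsBoundedLipschitz S) (hL : 0 < L) (d : ℝ) :
    Submodule ℂ (Quadruple S L d) where
  carrier := {p | IsFieldData S L d p}
  zero_mem' := isFieldData_zero
  add_mem' := fun hp hq => hp.add hS hL hq
  smul_mem' := fun c _ hp => hp.smul c

/-- This supplies the completeness needed for Lax–Milgram. Convergence of quadruples is `L²`
convergence of all four components, which is what the stability lemmas for Green's formula and for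
tangential traces require. -/
lemma isClosed_fieldSpace (hS : IsBoundedLipschitz S) (hL : 0 < L) (d : ℝ) :
    IsClosed (fieldSpace hS hL d : Set (Quadruple S L d)) := by
  refine IsSeqClosed.isClosed fun pn p hpn hp => ?_
  have hpn : ∀ n, IsFieldData S L d (pn n) := hpn
  have hfst := ((WithLp.continuous_fst 2 _ _).tendsto p).comp hp
  have hsnd := ((WithLp.continuous_snd 2 _ _).tendsto p).comp hp
  have hu := (Lp.tendsto_Lp_iff_tendsto_eLpNorm' _ _).1
    (((WithLp.continuous_fst 2 _ _).tendsto _).comp hfst)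
  have hw := (Lp.tendsto_Lp_iff_tendsto_eLpNorm' _ _).1
    (((WithLp.continuous_snd 2 _ _).tendsto _).comp hfst)
  have hs := (Lp.tendsto_Lp_iff_tendsto_eLpNorm' _ _).1
    (((WithLp.continuous_fst 2 _ _).tendsto _).comp hsnd)
  have hg := (Lp.tendsto_Lp_iff_tendsto_eLpNorm' _ _).1
    (((WithLp.continuous_snd 2 _ _).tendsto _).comp hsnd)
  have hmono : ∀ {α : Type} [MeasurableSpace α] {m m' : Measure α} {f : ℕ → α → C3},
      m' ≤ m → Tendsto (fun n => eLpNorm (f n) 2 m) atTop (𝓝 0) →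
      Tendsto (fun n => eLpNorm (f n) 2 m') atTop (𝓝 0) := fun hm h =>
    tendsto_of_tendsto_of_tendsto_of_le_of_le tendsto_const_nhds h (fun _ => zero_le)
      fun _ => eLpNorm_mono_measure _ hm
  refine (⟨?_, fun k hk => ?_, ?_⟩ : IsFieldData S L d p)
  · refine (isWeakCurl_iff_isGreen (Lp.memLp _) (Lp.memLp _)).2 ?_
    exact IsGreen.of_tendsto
      (fun n => (isWeakCurl_iff_isGreen (Lp.memLp _) (Lp.memLp _)).1 (hpn n).weakCurl)
      (fun n => Lp.memLp _) (Lp.memLp _) (fun n => Lp.memLp _) (Lp.memLp _)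
      (fun n => MemLp.zero) MemLp.zero hu hw (by simp)
  · exact IsTangentialTrace.of_tendsto (hasFiniteArea_sheet hS.isBounded _) (fun x => by simp)
      (fun n => (hpn n).onSheets k hk) (fun n => memLp_part _ _) (memLp_part _ _)
      (fun n => memLp_part _ _) (memLp_part _ _) (fun n => memLp_sheet hk _) (memLp_sheet hk _)
      (hmono (Measure.restrict_mono inter_subset_left le_rfl) hu)
      (hmono (Measure.restrict_mono inter_subset_left le_rfl) hw)
      (hmono (Measure.restrict_mono (sheet_subset_sheets hk) le_rfl) hs)
  · exact IsTangentialTrace.of_tendsto (hS.hasFiniteArea_frontier hL) (norm_outerNormal_le _)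
      (fun n => (hpn n).onBoundary) (fun n => Lp.memLp _) (Lp.memLp _)
      (fun n => Lp.memLp _) (Lp.memLp _) (fun n => Lp.memLp _) (Lp.memLp _) hu hw hg

/-- The quadruple of a field. -/
noncomputable def quadruple (d : ℝ) (u : L2 (prism S L)) : Quadruple S L d :=
  WithLp.toLp 2 (WithLp.toLp 2 (u, curl u),
    WithLp.toLp 2 (sheetTrace S L d u, boundaryTrace u))

lemma quadruple_mem (hS : IsBoundedLipschitz S) (hL : 0 < L) {u : L2 (prism S L)}
    (hu : u ∈ X S L d) : quadruple d u ∈ fieldSpace hS hL d := by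
  obtain ⟨h1, h2, h3⟩ := hu
  refine (⟨?_, ?_, ?_⟩ : IsFieldData S L d (quadruple d u))
  · change IsWeakCurl (prism S L) u (curl u)
    unfold curl
    have hex : ∃ w : L2 (prism S L), IsWeakCurl (prism S L) u w := h1
    rw [dif_pos hex]
    exact hex.choose_spec
  · change IsSheetTrace S L d u (sheetTrace S L d u)
    unfold sheetTrace
    rw [dif_pos h3]
    exact h3.choose_spec
  · change IsBoundaryTrace u (boundaryTrace u)
    unfold boundaryTrace
    rw [dif_pos h2]
    exact h2.choose_spec

lemma ae_sheets_of_forall {P : R3 → Prop}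
    (h : ∀ k ∈ sheetIndices L d, ∀ᵐ x ∂(μHE[2] : Measure R3).restrict (sheet S (k * d)), P x) :
    ∀ᵐ x ∂(μHE[2] : Measure R3).restrict (sheets S L d), P x :=
  (ae_restrict_biUnion_iff _ (Set.to_countable _) _).2 h

/-- Curl and traces are determined by the field. -/
lemma IsFieldData.ext (hS : IsBoundedLipschitz S) (hL : 0 < L) (hd : 0 < d)
    {p q : Quadruple S L d} (hp : IsFieldData S L d p) (hq : IsFieldData S L d q)
    (h : p.fst.fst = q.fst.fst) : p = q := by
  have hw : p.fst.snd = q.fst.snd := by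
    have hqw := hq.weakCurl
    rw [← h] at hqw
    exact Lp.ext (hp.weakCurl.ae_eq (isOpen_prism hS.isOpen L) hqw (Lp.memLp _) (Lp.memLp _))
  have hs : p.snd.fst = q.snd.fst := by
    refine Lp.ext (ae_sheets_of_forall fun k hk => ?_)
    have hqs := hq.onSheets k hk
    rw [← h, ← hw] at hqs
    refine (hp.onSheets k hk).ae_eq (hasFiniteArea_sheet hS.isBounded _)
      (isOpen_prism hS.isOpen L) ?_ hqs
    filter_upwards [ae_restrict_mem (measurableSet_sheet hS.isOpen _)] with x hx
    exact sheet_subset_prism hd hk hx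
  have hg : p.snd.snd = q.snd.snd := by
    have hqg := hq.onBoundary
    rw [← h, ← hw] at hqg
    exact Lp.ext (hp.onBoundary.ae_eq (hS.hasFiniteArea_frontier hL) isOpen_univ
      (.of_forall fun _ => mem_univ _) hqg)
  exact WithLp.ofLp_injective 2 (Prod.ext (WithLp.ofLp_injective 2 (Prod.ext h hw))
    (WithLp.ofLp_injective 2 (Prod.ext hs hg)))

lemma IsFieldData.mem_X (hS : IsBoundedLipschitz S) {p : Quadruple S L d}
    (hp : IsFieldData S L d p) : p.fst.fst ∈ X S L d := by
  have hex : ∃ w : L2 (prism S L), IsWeakCurl (prism S L) p.fst.fst w := ⟨_, hp.weakCurl⟩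
  -- The traces in `X` are defined through the chosen `curl`, so it has to be identified with the
  -- curl stored in `p` first.
  have hcurl : curl p.fst.fst = p.fst.snd := by
    unfold curl
    rw [dif_pos hex]
    exact Lp.ext (hex.choose_spec.ae_eq (isOpen_prism hS.isOpen L) hp.weakCurl
      (Lp.memLp _) (Lp.memLp _))
  refine ⟨hex, ⟨p.snd.snd, ?_⟩, ⟨p.snd.fst, ?_⟩⟩
  · unfold IsBoundaryTrace
    rw [hcurl]
    exact hp.onBoundary
  · unfold IsSheetTrace
    rw [hcurl]
    exact hp.onSheets

/-- Together with `quadruple_mem` this identifies `fieldSpace` with the graph over `X`, so testing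
against the subspace is testing against `X`. -/
lemma eq_quadruple (hS : IsBoundedLipschitz S) (hL : 0 < L) (hd : 0 < d)
    {p : Quadruple S L d} (hp : IsFieldData S L d p) : p = quadruple d p.fst.fst :=
  hp.ext hS hL hd (quadruple_mem hS hL (hp.mem_X hS)) rfl

/-- The minus signs of the form are absorbed into the coefficients, so that coercivity can be
checked block by block. -/
lemma form_eq_inner {ω μ lam : ℝ} {ε σ : R3 → ℂ}
    (hε : MemLp (fun x => -((ω : ℂ) ^ 2 * ε x)) ⊤ (volume.restrict (prism S L)))
    (hμ : MemLp (fun _ : R3 => ((1 / μ : ℝ) : ℂ)) ⊤ (volume.restrict (prism S L)))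
    (hσ : MemLp (fun x => -(Complex.I * ω * σ x)) ⊤
      ((μHE[2] : Measure R3).restrict (sheets S L d)))
    (hlam : MemLp (fun _ : R3 => -(Complex.I * ω * lam)) ⊤
      ((μHE[2] : Measure R3).restrict (frontier (prism S L)))) (u v : L2 (prism S L)) :
    form S L d ω μ lam ε σ u v = inner ℂ (quadruple d v)
      (diagonalOp (diagonalOp (mulOp _ hε) (mulOp _ hμ)) (diagonalOp (mulOp _ hσ) (mulOp _ hlam))
        (quadruple d u)) := by
  have e : ∀ a₁ a₂ a₃ a₄ : ℂ, a₂ - a₁ - a₃ - a₄ = -a₁ + a₂ + (-a₃ + -a₄) := by intros; ring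
  simp only [inner_diagonalOp, inner_mulOp, neg_mul, integral_neg]
  exact e _ _ _ _

lemma inner_quadruple (u f : L2 (prism S L)) :
    inner ℂ (quadruple d u) (WithLp.toLp 2 (WithLp.toLp 2 (f, 0), 0)) = inner ℂ u f := by
  simp [quadruple]

lemma min_mul_norm_sq_le {f₁ f₂ f₃ f₄ : R3 → ℂ}
    (h₁ : MemLp f₁ ⊤ (volume.restrict (prism S L))) (h₂ : MemLp f₂ ⊤ (volume.restrict (prism S L)))
    (h₃ : MemLp f₃ ⊤ ((μHE[2] : Measure R3).restrict (sheets S L d)))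
    (h₄ : MemLp f₄ ⊤ ((μHE[2] : Measure R3).restrict (frontier (prism S L))))
    {z : ℂ} {b₁ b₂ b₃ b₄ : ℝ}
    (hb₁ : ∀ᵐ x ∂volume.restrict (prism S L), b₁ ≤ (z * f₁ x).re)
    (hb₂ : ∀ᵐ x ∂volume.restrict (prism S L), b₂ ≤ (z * f₂ x).re)
    (hb₃ : ∀ᵐ x ∂(μHE[2] : Measure R3).restrict (sheets S L d), b₃ ≤ (z * f₃ x).re)
    (hb₄ : ∀ᵐ x ∂(μHE[2] : Measure R3).restrict (frontier (prism S L)), b₄ ≤ (z * f₄ x).re)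
    (p : Quadruple S L d) :
    min (min b₁ b₂) (min b₃ b₄) * ‖p‖ ^ 2 ≤ (z * inner ℂ p
      (diagonalOp (diagonalOp (mulOp f₁ h₁) (mulOp f₂ h₂))
        (diagonalOp (mulOp f₃ h₃) (mulOp f₄ h₄)) p)).re :=
  diagonalOp_coercive
    (diagonalOp_coercive
      (mulOp_coercive h₁ _ ((min_le_left _ _).trans (min_le_left _ _)) hb₁)
      (mulOp_coercive h₂ _ ((min_le_left _ _).trans (min_le_right _ _)) hb₂))
    (diagonalOp_coercive
      (mulOp_coercive h₃ _ ((min_le_right _ _).trans (min_le_left _ _)) hb₃)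
      (mulOp_coercive h₄ _ ((min_le_right _ _).trans (min_le_right _ _)) hb₄))

/-- Well-posedness of the variational problem, once the form is represented by an operator that is
coercive after multiplication with some complex number. -/
lemma existsUnique_of_form_eq (hS : IsBoundedLipschitz S) (hL : 0 < L) (hd : 0 < d)
    {a : L2 (prism S L) → L2 (prism S L) → ℂ} (T : Quadruple S L d →L[ℂ] Quadruple S L d)
    (hT : ∀ u v, a u v = inner ℂ (quadruple d v) (T (quadruple d u))) {z : ℂ} (hz : z ≠ 0) {b : ℝ}
    (hb : 0 < b) (hcoer : ∀ p, b * ‖p‖ ^ 2 ≤ (z * inner ℂ p (T p)).re) (f : L2 (prism S L)) :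
    ∃! E : L2 (prism S L), E ∈ X S L d ∧ ∀ Ψ ∈ X S L d, a E Ψ = inner ℂ Ψ f := by
  have hz0 : 0 < ‖z‖ := norm_pos_iff.2 hz
  have : CompleteSpace (fieldSpace hS hL d) := (isClosed_fieldSpace hS hL d).completeSpace_coe
  obtain ⟨p, ⟨hp, hpv⟩, huniq⟩ := existsUnique_of_coercive (fieldSpace hS hL d) T
    (div_pos hb hz0) (fun p _ => by
      rw [div_mul_eq_mul_div, div_le_iff₀ hz0, mul_comm ‖_‖ ‖z‖, ← norm_mul]
      exact (hcoer p).trans (Complex.re_le_norm _))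
    -- The source pairs with the field alone, so its curl and trace entries vanish.
    (WithLp.toLp 2 (WithLp.toLp 2 (f, 0), 0))
  have hp' : IsFieldData S L d p := hp
  have hpq := eq_quadruple hS hL hd hp'
  refine ⟨p.fst.fst, ⟨hp'.mem_X hS, fun Ψ hΨ => ?_⟩, ?_⟩
  · rw [hT, ← hpq, hpv _ (quadruple_mem hS hL hΨ), inner_quadruple]
  · rintro E ⟨hE, hEv⟩
    have h := huniq (quadruple d E) ⟨quadruple_mem hS hL hE, fun v hv => by
      have hv' : IsFieldData S L d v := hv
      rw [eq_quadruple hS hL hd hv', ← hT, inner_quadruple, hEv _ (hv'.mem_X hS)]⟩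
    exact congrArg (fun q : Quadruple S L d => q.fst.fst) h

end Graph

end LayeredMaxwell

theorem theorem1 (S : Set R2) (hS : IsBoundedLipschitz S) (L : ℝ) (hL : 0 < L)
    (d : ℝ) (hd : 0 < d) (ω μ lam : ℝ) (hω : 0 < ω) (hμ : 0 < μ) (hlam : 0 < lam)
    (ε σ : R3 → ℂ)
    (hε_meas : AEStronglyMeasurable ε (volume.restrict (prism S L)))
    (hσ_meas : AEStronglyMeasurable σ ((μHE[2] : Measure R3).restrict (sheets S L d)))
    (c C : ℝ) (hc : 0 < c)
    (hε_im : ∀ x ∈ prism S L, c ≤ (ε x).im ∧ (ε x).im ≤ C)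
    (hε_re : ∀ x ∈ prism S L, |(ε x).re| ≤ C)
    (hσ_re : ∀ x ∈ sheets S L d, c ≤ 1 / d * (σ x).re ∧ 1 / d * (σ x).re ≤ C)
    (hσ_im : ∀ x ∈ sheets S L d, |1 / d * (σ x).im| ≤ C)
    (J : L2 (prism S L)) :
    ∃! E : L2 (prism S L), E ∈ X S L d ∧
      ∀ Ψ ∈ X S L d,
        form S L d ω μ lam ε σ E Ψ =
          Complex.I * ω * ∫ x in prism S L, inner ℂ (Ψ x) (J x) := by
  have hΩ : ∀ᵐ x ∂(volume : Measure R3).restrict (prism S L), x ∈ prism S L :=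
    ae_restrict_mem (isOpen_prism hS.isOpen L).measurableSet
  have hsh : ∀ᵐ x ∂(μHE[2] : Measure R3).restrict (sheets S L d), x ∈ sheets S L d :=
    ae_restrict_mem (measurableSet_sheets hS.isOpen L d)
  have hσ_re' : ∀ x ∈ sheets S L d, d * c ≤ (σ x).re ∧ (σ x).re ≤ d * C := fun x hx => by
    have h := hσ_re x hx
    rw [one_div_mul_eq_div, le_div_iff₀ hd, div_le_iff₀ hd] at h
    exact ⟨by linarith [h.1], by linarith [h.2]⟩
  have hσ_im' : ∀ x ∈ sheets S L d, |(σ x).im| ≤ d * C := fun x hx => by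
    have h := hσ_im x hx
    rw [one_div_mul_eq_div, abs_div, abs_of_pos hd, div_le_iff₀ hd] at h
    linarith
  have m1 : MemLp (fun x => -((ω : ℂ) ^ 2 * ε x)) ⊤ (volume.restrict (prism S L)) := by
    refine MemLp.neg (MemLp.const_mul (memLp_top_of_bound hε_meas (C + C) ?_) _)
    filter_upwards [hΩ] with x hx
    refine (Complex.norm_le_abs_re_add_abs_im _).trans (add_le_add (hε_re x hx) ?_)
    rw [abs_of_nonneg (hc.le.trans (hε_im x hx).1)]
    exact (hε_im x hx).2
  have m2 : MemLp (fun _ : R3 => ((1 / μ : ℝ) : ℂ)) ⊤ (volume.restrict (prism S L)) :=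
    memLp_top_const _
  have m3 : MemLp (fun x => -(Complex.I * ω * σ x)) ⊤
      ((μHE[2] : Measure R3).restrict (sheets S L d)) := by
    refine MemLp.neg (MemLp.const_mul (memLp_top_of_bound hσ_meas (d * C + d * C) ?_) _)
    filter_upwards [hsh] with x hx
    refine (Complex.norm_le_abs_re_add_abs_im _).trans (add_le_add ?_ (hσ_im' x hx))
    rw [abs_of_nonneg ((mul_pos hd hc).le.trans (hσ_re' x hx).1)]
    exact (hσ_re' x hx).2
  have m4 : MemLp (fun _ : R3 => -(Complex.I * ω * lam)) ⊤
      ((μHE[2] : Measure R3).restrict (frontier (prism S L))) := memLp_top_const _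
  -- Chosen so that `M * c - C ≥ 1`, which leaves the lower bounds `ω ^ 2` for the `ε` term and `ω *
  -- d` for the `σ` term. The absolute value keeps `M` positive even when `Ω` is empty and `C` is
  -- unconstrained.
  set M : ℝ := (|C| + 1) / c with hM
  have hM0 : 0 < M := by positivity
  have hMc : M * c = |C| + 1 := div_mul_cancel₀ _ hc.ne'
  have hz : (⟨1, M⟩ : ℂ) ≠ 0 := fun h => by simpa using congrArg Complex.re h
  have hpos : 0 < min (min (ω ^ 2) (1 / μ)) (min (ω * d) (M * (ω * lam))) := by positivity
  -- The curl and boundary coefficients are constant, so `1 / μ` and `M * (ω * lam)` are the exact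
  -- real parts after multiplication by `1 + iM`.
  have hcoer := min_mul_norm_sq_le m1 m2 m3 m4 (z := ⟨1, M⟩) (b₁ := ω ^ 2) (b₂ := 1 / μ)
    (b₃ := ω * d) (b₄ := M * (ω * lam)) (by
      filter_upwards [hΩ] with x hx
      have e : ((⟨1, M⟩ : ℂ) * -((ω : ℂ) ^ 2 * ε x)).re = ω ^ 2 * (M * (ε x).im - (ε x).re) := by
        rw [← Complex.ofReal_pow]
        simp only [Complex.mul_re, Complex.neg_re, Complex.neg_im, Complex.im_ofReal_mul,
          Complex.ofReal_re, Complex.ofReal_im]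
        ring
      rw [e]
      refine le_mul_of_one_le_right (sq_nonneg ω) ?_
      have h1 := mul_le_mul_of_nonneg_left (hε_im x hx).1 hM0.le
      linarith [(abs_le.1 (hε_re x hx)).2, le_abs_self C])
    (.of_forall fun x => by simp)
    (by
      filter_upwards [hsh] with x hx
      have e : ((⟨1, M⟩ : ℂ) * -(Complex.I * ω * σ x)).re = ω * (M * (σ x).re + (σ x).im) := by
        simp [Complex.mul_re, Complex.mul_im]
        ring
      rw [e]
      refine mul_le_mul_of_nonneg_left ?_ hω.le
      have h1 := mul_le_mul_of_nonneg_left (hσ_re' x hx).1 hM0.le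
      have h2 : M * (d * c) = d * |C| + d := by rw [mul_left_comm, hMc]; ring
      have h3 := mul_le_mul_of_nonneg_left (le_abs_self C) hd.le
      linarith [(abs_le.1 (hσ_im' x hx)).1])
    (.of_forall fun x => by simp [Complex.mul_re, Complex.mul_im])
  have h := existsUnique_of_form_eq hS hL hd _ (form_eq_inner m1 m2 m3 m4) hz hpos hcoer
    ((Complex.I * ω) • J)
  simpa only [inner_smul_right, L2.inner_def] using h
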